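/- Let $N,L\ge 0$ and $R\ge 1$ be integers and let $\widehat u:\mathbb R^N\times\mathbb R^L\to\mathbb R^N$, $(z,\Theta)\mapsto\widehat u(z;\Theta)$, be such that: for every $\Theta$ the map $z\mapsto\widehat u(z;\Theta)$ is Lipschitz; the maps $\Theta\mapsto\widehat u(z;\Theta)$ are Lipschitz with a constant independent of $z$; and $\widehat u(0;\Theta)=0$ for all $\Theta$. Let $z=\bar u+\sigma\zeta$ with $\bar u\in\mathbb R^N$, $\sigma>0$, $\zeta\sim\mathcal N(0,I_N)$, and let $\Delta=(\delta^{(1)},\dots,\delta^{(R)})$ be independent $\mathcal N(0,I_N)$ vectors, with $\Delta$ independent of $\zeta$. Let $Q(\Theta)=\mathbb E\|\widehat u(z;\Theta)-\bar u\|_2^2$. Write $\partial_\Theta\widehat u(z;\Theta)$ for the Jacobian in $\Theta$ (set to $0$ where $\widehat u(z;\cdot)$ is not differentiable). For $\epsilon>0$ and $\delta\in\mathbb R^N$ put $$\mathrm{SURE}_{\epsilon,\delta}(z;\Theta)=\|\widehat u(z;\Theta)-z\|_2^2+\tfrac2\epsilon\langle\widehat u(z+\epsilon\delta;\Theta)-\widehat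 u(z;\Theta),\sigma^2\delta\rangle-\sigma^2N,$$ $$\mathrm{SUGAR}_{\epsilon,\delta}(z;\Theta)=2\,\partial_\Theta\widehat u(z;\Theta)^*(\widehat u(z;\Theta)-z)+\tfrac2\epsilon\bigl(\partial_\Theta\widehat u(z+\epsilon\delta;\Theta)-\partial_\Theta\widehat u(z;\Theta)\bigr)^*\sigma^2\delta,$$ and let $\overline{\mathrm{SURE}}^R_{\epsilon,\Delta}=\frac1R\sum_{r=1}^R\mathrm{SURE}_{\epsilon,\delta^{(r)}}$ and $\overline{\mathrm{SUGAR}}^R_{\epsilon,\Delta}=\frac1R\sum_{r=1}^R\mathrm{SUGAR}_{\epsilon,\delta^{(r)}}$. A weak gradient of a function $f$ on $\mathbb R^L$ is a locally integrable $g:\mathbb R^L\to\mathbb R^L$ with $\int f\,\partial_v\varphi=-\int\langle g,v\rangle\varphi$ for all $\varphi\in C_c^\infty(\mathbb R^L)$ and $v\in\mathbb R^L$, where $f$ is itself locally integrable. Then: (1) For every $\Theta$, $Q(\Theta)$ is finite, $\overline{\mathrm{SURE}}^R_{\epsilon,\Delta}(z;\Theta)$ is integrable for every $\epsilon>0$,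 and $\lim_{\epsilon\to0^+}\mathbb E[\overline{\mathrm{SURE}}^R_{\epsilon,\Delta}(z;\Theta)]=Q(\Theta)$. (2) $\overline{\mathrm{SUGAR}}^R_{\epsilon,\Delta}(z;\Theta)$ is integrable for all $\Theta$ and $\epsilon>0$. For Lebesgue-almost every $\Theta$, the map $\widehat u(z;\cdot)$ is almost surely differentiable at $\Theta$. At every $\Theta$ with this last property, $Q$ is differentiable and $\lim_{\epsilon\to0^+}\mathbb E[\overline{\mathrm{SUGAR}}^R_{\epsilon,\Delta}(z;\Theta)]=\nabla Q(\Theta)$. Moreover the almost-everywhere defined classical gradient $\nabla Q$ is a weak gradient of $Q$. (3) For every $\epsilon>0$ and every realization of $z$ and $\Delta$ (that is, for arbitrary fixed vectors of $\mathbb R^N$), $\overline{\mathrm{SUGAR}}^R_{\epsilon,\Delta}(z;\cdot)$ is the gradient of $\overline{\mathrm{SURE}}^R_{\epsilon,\Delta}(z;\cdot)$: it is a weak gradient on $\mathbb R^L$, and it is the classical gradient at almost every $\Theta$, in particular at every $\Theta$ at which $\widehat u(z;\cdot)$ and all the $\widehat u(z+\epsilon\delta^{(r)};\cdot)$ are differentiable.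 -/

import Mathlib

open MeasureTheory ProbabilityTheory Filter Topology
open scoped NNReal

noncomputable section

/-- The Euclidean space `ℝⁿ`. -/
abbrev Euc (n : ℕ) : Type := EuclideanSpace ℝ (Fin n)

/-- The observations `z = ū + σ ζ`. -/
def observation {Ω : Type*} {N : ℕ} (ubar : Euc N) (σ : ℝ) (ζ : Ω → Euc N) (ω : Ω) : Euc N :=
  ubar + σ • ζ ω

/-- The quadratic risk `Q[û](Θ) = E ‖û(z;Θ) - ū‖²` under the model `z = ū + σ ζ`. -/
def quadraticRisk {Ω : Type*} [MeasurableSpace Ω] {N L : ℕ} (P : Measure Ω)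
    (uhat : Euc N → Euc L → Euc N) (ubar : Euc N) (σ : ℝ) (ζ : Ω → Euc N) (Θ : Euc L) : ℝ :=
  ∫ ω, ‖uhat (observation ubar σ ζ ω) Θ - ubar‖ ^ 2 ∂P

/-- The Jacobian `∂_Θ û(z;Θ)` of the estimator in the hyperparameters. -/
def jacobian {N L : ℕ} (uhat : Euc N → Euc L → Euc N) (z : Euc N) (Θ : Euc L) :
    Euc L →L[ℝ] Euc N :=
  fderiv ℝ (fun Θ' => uhat z Θ') Θ

/-- The Finite Difference Monte Carlo SURE with step `ε` and probe vector `d`. -/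
def fdmcSure {N L : ℕ} (uhat : Euc N → Euc L → Euc N) (σ ε : ℝ) (d z : Euc N) (Θ : Euc L) : ℝ :=
  ‖uhat z Θ - z‖ ^ 2
    + (2 / ε) * inner ℝ (uhat (z + ε • d) Θ - uhat z Θ) (σ ^ 2 • d)
    - σ ^ 2 * (N : ℝ)

/-- The Finite Difference Monte Carlo SUGAR with step `ε` and probe vector `d`. -/
def fdmcSugar {N L : ℕ} (uhat : Euc N → Euc L → Euc N) (σ ε : ℝ) (d z : Euc N) (Θ : Euc L) :
    Euc L :=
  (2 : ℝ) • (jacobian uhat z Θ).adjoint (uhat z Θ - z)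
    + (2 / ε) • (jacobian uhat (z + ε • d) Θ - jacobian uhat z Θ).adjoint (σ ^ 2 • d)

/-- The Monte Carlo averaged SURE over the probe vectors `D 0, …, D (R - 1)`. -/
def avgSure {N L R : ℕ} (uhat : Euc N → Euc L → Euc N) (σ ε : ℝ) (D : Fin R → Euc N)
    (z : Euc N) (Θ : Euc L) : ℝ :=
  (1 / (R : ℝ)) * ∑ r, fdmcSure uhat σ ε (D r) z Θ

/-- The Monte Carlo averaged SUGAR over the probe vectors `D 0, …, D (R - 1)`. -/
def avgSugar {N L R : ℕ} (uhat : Euc N → Euc L → Euc N) (σ ε : ℝ) (D : Fin R → Euc N)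
    (z : Euc N) (Θ : Euc L) : Euc L :=
  (1 / (R : ℝ)) • ∑ r, fdmcSugar uhat σ ε (D r) z Θ

/-- `g` is a weak gradient of `f` on `ℝᴸ`: both are locally integrable and
`∫ f ∂ᵥφ = - ∫ ⟨g, v⟩ φ` for all smooth compactly supported `φ` and all directions `v`. -/
def HasWeakGradient {L : ℕ} (f : Euc L → ℝ) (g : Euc L → Euc L) : Prop :=
  LocallyIntegrable f volume ∧ LocallyIntegrable g volume ∧
    ∀ φ : Euc L → ℝ, ContDiff ℝ (⊤ : ℕ∞) φ → HasCompactSupport φ → ∀ v : Euc L,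
      ∫ x, f x * fderiv ℝ φ x v = - ∫ x, inner ℝ (g x) v * φ x

end

/-!
The argument uses no derivative of the estimator in the observation, and Stein's lemma only in
finite difference form. Let `x, y` be independent standard Gaussian vectors, so that
`z = ū + σ x` and the probe vector is `y`. Both the divergence term of SURE and the corresponding
term of SUGAR have the shape
`ε⁻¹ E[(H (σ x + ε y) - H (σ x)) (σ² y)]` for an operator valued map `H`: the pairing with
`û(ū + ·; Θ)` in the first case, the adjoint Jacobian `∂_Θ û(ū + ·; Θ)^*` in the second. By
independence `E[H (σ x) y] = 0`. In the other half of the difference, `σ x + ε y = s w` with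
`s = √(σ² + ε²)` and `w` standard Gaussian, and rotation invariance shows that `y` is
`(ε / s) w` plus a centred vector independent of `w`. Hence the whole quantity equals
`(σ / s)² E[H (s w) (s w)]` (`integral_rotation_stdGaussian`). As `ε → 0` it tends to
`E[H (σ w) (σ w)]`, that is `E[H (z - ū)]`, because Gaussian averages depend continuously on the
dilation `s` even when the integrand is merely measurable, the dilation being carried by the
density (`tendsto_integral_smul_stdGaussian`). This matters for SUGAR, since the Jacobian need not
be continuous in `z`. Together these facts are `tendsto_integral_finiteDiff_stdGaussian`. Expanding
`û - ū = (û - z) + (z - ū)` then turns the limits into the risk and into the average of the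
gradient `2 ∂_Θ û^* (û - ū)` of the loss.

The latter is the gradient of the risk by dominated differentiation, the domination coming from the
uniform Lipschitz bound in `Θ` (`hasGradientAt_gaussianRisk`). Rademacher's theorem and Fubini's
theorem give almost sure differentiability at almost every `Θ`. Finally, the risk and the averaged
SURE are Lipschitz on balls as functions of `Θ`, and for such functions the classical gradient is
a weak gradient (`hasWeakGradient_of_lipschitzOn_balls`).
-/

/-! ### Gaussian integration -/

lemma linear_mul_le_quadratic {C : ℝ} (hC : 0 ≤ C) (a b : ℝ) :
    C * (1 + a) * b ≤ 2 * C * (1 + a ^ 2 + b ^ 2) := by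
  nlinarith [mul_nonneg hC (sq_nonneg (a - b)), mul_nonneg hC (sq_nonneg (b - 1)),
    mul_nonneg hC (sq_nonneg a), mul_nonneg hC (sq_nonneg b)]

lemma stronglyMeasurable_clm_apply {α E V : Type*} [MeasurableSpace α] [NormedAddCommGroup E]
    [NormedSpace ℝ E] [NormedAddCommGroup V] [NormedSpace ℝ V] {H : α → E →L[ℝ] V}
    {v : α → E} (hH : StronglyMeasurable H) (hv : StronglyMeasurable v) :
    StronglyMeasurable fun a => H a (v a) :=
  isBoundedBilinearMap_apply.continuous.comp_stronglyMeasurable (hH.prodMk hv)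

section GaussianIntegration

variable {E : Type*} [NormedAddCommGroup E] [InnerProductSpace ℝ E] [FiniteDimensional ℝ E]
  [MeasurableSpace E] [BorelSpace E]
variable {V : Type*} [NormedAddCommGroup V] [NormedSpace ℝ V]

lemma integrable_norm_pow_stdGaussian (k : ℕ) :
    Integrable (fun x : E => ‖x‖ ^ k) (stdGaussian E) :=
  (IsGaussian.memLp_id (stdGaussian E) k (by simp)).integrable_norm_pow'

lemma integral_norm_sq_stdGaussian :
    ∫ x : E, ‖x‖ ^ 2 ∂(stdGaussian E) = Module.finrank ℝ E := by
  have hb (x : E) : ‖x‖ ^ 2 = ∑ i, (inner ℝ (stdOrthonormalBasis ℝ E i) x) ^ 2 :=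
    ((stdOrthonormalBasis ℝ E).sum_sq_inner_right x).symm
  have hint (i) : Integrable (fun x : E => (inner ℝ (stdOrthonormalBasis ℝ E i) x) ^ 2)
      (stdGaussian E) := by
    refine (integrable_norm_pow_stdGaussian 2).mono' (by fun_prop) (ae_of_all _ fun x => ?_)
    rw [hb x, Real.norm_of_nonneg (sq_nonneg _)]
    exact Finset.single_le_sum
      (f := fun i => (inner ℝ (stdOrthonormalBasis ℝ E i) x) ^ 2) (fun _ _ => sq_nonneg _)
      (Finset.mem_univ i)
  have hvar (i) : ∫ x : E, (inner ℝ (stdOrthonormalBasis ℝ E i) x) ^ 2 ∂(stdGaussian E) = 1 := by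
    have h := variance_dual_stdGaussian (E := E) (innerSL ℝ (stdOrthonormalBasis ℝ E i))
    rw [variance_of_integral_eq_zero (by fun_prop) (integral_strongDual_stdGaussian _)] at h
    simpa using h
  simp_rw [hb]
  rw [integral_finsetSum _ fun i _ => hint i]
  simp [hvar]

lemma integrable_exp_neg_half_norm_sq :
    Integrable (fun x : E => Real.exp (-‖x‖ ^ 2 / 2)) := by
  have h := (GaussianFourier.integrable_cexp_neg_mul_sq_norm_add (V := E) (b := 1 / 2)
    (by norm_num) 0 0).norm
  refine h.congr (ae_of_all _ fun x => ?_)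
  simp only [zero_mul, add_zero, Complex.norm_exp]
  congr 1
  rw [show (-(1 / 2) * (‖x‖ : ℂ) ^ 2) = ((-(1 / 2) * ‖x‖ ^ 2 : ℝ) : ℂ) by push_cast; ring,
    Complex.ofReal_re]
  ring

/-- The Lebesgue density of the standard Gaussian measure; only its shape matters below, so the
normalising constant is left implicit. It is identified through characteristic functions. -/
lemma exists_stdGaussian_eq_withDensity :
    ∃ c : ℝ, 0 ≤ c ∧ stdGaussian E =
      volume.withDensity fun x : E => ENNReal.ofReal (c * Real.exp (-‖x‖ ^ 2 / 2)) := by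
  set Z : ℝ := ∫ x : E, Real.exp (-‖x‖ ^ 2 / 2) with hZ
  have hZpos : 0 < Z := integral_exp_pos integrable_exp_neg_half_norm_sq
  refine ⟨Z⁻¹, by positivity, ?_⟩
  have hfour (t : E) : ∫ x : E, Complex.exp (-‖x‖ ^ 2 / 2 + Complex.I * inner ℝ t x)
      = Z * Complex.exp (-‖t‖ ^ 2 / 2) := by
    have h (t : E) : ∫ x : E, Complex.exp (-‖x‖ ^ 2 / 2 + Complex.I * inner ℝ t x)
        = (Real.pi / (1 / 2) : ℂ) ^ (Module.finrank ℝ E / 2 : ℂ)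
          * Complex.exp (-‖t‖ ^ 2 / 2) := by
      have := GaussianFourier.integral_cexp_neg_mul_sq_norm_add (V := E) (b := 1 / 2)
        (by norm_num) Complex.I t
      rw [Complex.I_sq] at this
      convert this using 3
      · congr 1; ring
      · congr 1
        · ring
        · norm_num
    have h0 : (Z : ℂ) = (Real.pi / (1 / 2) : ℂ) ^ (Module.finrank ℝ E / 2 : ℂ) := by
      have := h 0
      simp only [inner_zero_left, Complex.ofReal_zero, mul_zero, add_zero, norm_zero, ne_eq,
        OfNat.ofNat_ne_zero, not_false_eq_true, zero_pow, neg_zero, zero_div,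
        Complex.exp_zero, mul_one] at this
      rw [← this, hZ, ← integral_complex_ofReal]
      congr 1 with x
      push_cast
      rfl
    rw [h, h0]
  have hfin := isFiniteMeasure_withDensity_ofReal (μ := (volume : Measure E))
    (integrable_exp_neg_half_norm_sq.const_mul Z⁻¹).2
  refine Measure.ext_of_charFun (funext fun t => ?_)
  rw [charFun_stdGaussian, charFun_apply,
    integral_withDensity_eq_integral_toReal_smul (by fun_prop)
      (ae_of_all _ fun _ => ENNReal.ofReal_lt_top)]
  have hterm (x : E) : (ENNReal.ofReal (Z⁻¹ * Real.exp (-‖x‖ ^ 2 / 2))).toReal •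
      Complex.exp (inner ℝ x t * Complex.I)
      = (Z : ℂ)⁻¹ * Complex.exp (-‖x‖ ^ 2 / 2 + Complex.I * inner ℝ t x) := by
    rw [ENNReal.toReal_ofReal (by positivity), Complex.real_smul, Complex.exp_add,
      real_inner_comm, mul_comm Complex.I]
    push_cast
    ring
  simp_rw [hterm]
  rw [integral_const_mul, hfour, inv_mul_cancel_left₀ (by exact_mod_cast hZpos.ne')]

/-- Gaussian averages are continuous under dilation, even for discontinuous integrands: in the
density form of the integral the dilation is carried by the smooth density. -/
lemma tendsto_integral_smul_stdGaussian {g : E → V} (hg : StronglyMeasurable g) {C : ℝ}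
    (hC : ∀ x, ‖g x‖ ≤ C * (1 + ‖x‖ ^ 2)) {σ : ℝ} (hσ : 0 < σ) :
    Tendsto (fun s : ℝ => ∫ x, g (s • x) ∂(stdGaussian E)) (𝓝 σ)
      (𝓝 (∫ x, g (σ • x) ∂(stdGaussian E))) := by
  obtain ⟨c, hc, hγ⟩ := exists_stdGaussian_eq_withDensity (E := E)
  have hrep {s : ℝ} (hs : 0 < s) : ∫ x, g (s • x) ∂(stdGaussian E)
      = (s ^ Module.finrank ℝ E)⁻¹ • ∫ x, (c * Real.exp (-‖s⁻¹ • x‖ ^ 2 / 2)) • g x := by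
    rw [hγ, integral_withDensity_eq_integral_toReal_smul (by fun_prop)
      (ae_of_all _ fun _ => ENNReal.ofReal_lt_top)]
    have := Measure.integral_comp_smul (volume : Measure E)
      (fun x => (c * Real.exp (-‖s⁻¹ • x‖ ^ 2 / 2)) • g x) s
    rw [abs_of_nonneg (by positivity)] at this
    rw [← this]
    refine integral_congr_ae (ae_of_all _ fun x => ?_)
    dsimp only
    rw [ENNReal.toReal_ofReal (by positivity), smul_smul, inv_mul_cancel₀ hs.ne', one_smul]
  -- the density at scale `2σ` dominates the unnormalised densities at all scales `s < 2σ`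
  have hbound : Integrable fun x : E =>
      c * Real.exp (-‖(2 * σ)⁻¹ • x‖ ^ 2 / 2) * (C * (1 + ‖x‖ ^ 2)) := by
    have hpoly : Integrable (fun x : E => C * (1 + ‖(2 * σ) • x‖ ^ 2)) (stdGaussian E) := by
      simp_rw [norm_smul, mul_pow]
      exact ((integrable_const _).add ((integrable_norm_pow_stdGaussian 2).const_mul _)).const_mul _
    rw [hγ, integrable_withDensity_iff_integrable_smul' (by fun_prop)
      (ae_of_all _ fun _ => ENNReal.ofReal_lt_top)] at hpoly
    have h2 := (integrable_comp_smul_iff volume _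
      (inv_ne_zero (by positivity : (2 * σ) ≠ 0))).2 hpoly
    refine h2.congr (ae_of_all _ fun x => ?_)
    dsimp only
    rw [ENNReal.toReal_ofReal (by positivity), smul_smul, mul_inv_cancel₀ (by positivity),
      one_smul, smul_eq_mul]
  have hnear : ∀ᶠ s in 𝓝 σ, 0 < s ∧ s < 2 * σ :=
    (lt_mem_nhds hσ).and (gt_mem_nhds (by linarith))
  rw [hrep hσ]
  refine Tendsto.congr' (hnear.mono fun s hs => (hrep hs.1).symm) ?_
  refine Tendsto.smul ((tendsto_id.pow _).inv₀ (by positivity)) ?_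
  refine tendsto_integral_filter_of_dominated_convergence _ ?_ ?_ hbound (ae_of_all _ fun x => ?_)
  · exact Eventually.of_forall fun s =>
      (StronglyMeasurable.smul (by fun_prop) hg).aestronglyMeasurable
  · filter_upwards [hnear] with s hs
    refine ae_of_all _ fun x => ?_
    rw [norm_smul, Real.norm_of_nonneg (by positivity)]
    have h1 : ‖(2 * σ)⁻¹ • x‖ ≤ ‖s⁻¹ • x‖ := by
      rw [norm_smul, norm_smul, norm_inv, norm_inv, Real.norm_of_nonneg hs.1.le,
        Real.norm_of_nonneg (by positivity)]
      have := inv_anti₀ hs.1 hs.2.le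
      gcongr
    have h2 := hC x
    gcongr
  · refine Tendsto.smul_const ?_ _
    have hcont : ContinuousAt (fun s : ℝ => c * Real.exp (-‖s⁻¹ • x‖ ^ 2 / 2)) σ := by
      have := hσ.ne'
      fun_prop (disch := assumption)
    exact hcont

lemma integrable_prod_stdGaussian_of_norm_le {V : Type*} [NormedAddCommGroup V]
    {f : E × E → V}
    (hf : AEStronglyMeasurable f ((stdGaussian E).prod (stdGaussian E))) {C : ℝ}
    (hC : ∀ p, ‖f p‖ ≤ C * (1 + ‖p.1‖ ^ 2 + ‖p.2‖ ^ 2)) :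
    Integrable f ((stdGaussian E).prod (stdGaussian E)) := by
  refine Integrable.mono' (g := fun p : E × E => C * (1 + ‖p.1‖ ^ 2 + ‖p.2‖ ^ 2)) ?_ hf
    (ae_of_all _ hC)
  exact (((integrable_const _).add ((integrable_norm_pow_stdGaussian 2).comp_fst _)).add
    ((integrable_norm_pow_stdGaussian 2).comp_snd _)).const_mul _

/-- Gaussian regression through the rotation invariance of a pair of independent standard
Gaussian vectors: `y` is `sin θ` times the rotated first vector `cos θ x + sin θ y` plus a vector
which is centred and independent of it. -/
lemma integral_rotation_stdGaussian [CompleteSpace V] {H : E → E →L[ℝ] V}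
    (hH : StronglyMeasurable H) {C : ℝ} (hC : ∀ x, ‖H x‖ ≤ C * (1 + ‖x‖)) (θ : ℝ) :
    ∫ p : E × E, H (Real.cos θ • p.1 + Real.sin θ • p.2) p.2
        ∂((stdGaussian E).prod (stdGaussian E))
      = Real.sin θ • ∫ w, H w w ∂(stdGaussian E) := by
  have hC0 : 0 ≤ C := by simpa using (norm_nonneg _).trans (hC 0)
  have hrot := IsGaussian.map_rotation_eq_self (μ := stdGaussian E)
    (by simp) θ
  have hpt (p : E × E) : H (Real.cos θ • p.1 + Real.sin θ • p.2) p.2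
      = (fun q : E × E => Real.sin θ • H q.1 q.1 + Real.cos θ • H q.1 q.2)
          (ContinuousLinearMap.rotation θ p) := by
    simp only [ContinuousLinearMap.rotation_apply]
    rw [← map_smul, ← map_smul, ← map_add]
    congr 1
    simp only [smul_add, smul_smul]
    have := Real.sin_sq_add_cos_sq θ
    calc p.2 = (Real.sin θ ^ 2 + Real.cos θ ^ 2) • p.2 := by rw [this, one_smul]
      _ = _ := by module
  have hm1 : StronglyMeasurable fun q : E × E => H q.1 q.1 :=
    stronglyMeasurable_clm_apply (hH.comp_measurable measurable_fst) (by fun_prop)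
  have hm2 : StronglyMeasurable fun q : E × E => H q.1 q.2 :=
    stronglyMeasurable_clm_apply (hH.comp_measurable measurable_fst) (by fun_prop)
  have hi1 : Integrable (fun q : E × E => H q.1 q.1) ((stdGaussian E).prod (stdGaussian E)) := by
    refine integrable_prod_stdGaussian_of_norm_le hm1.aestronglyMeasurable (C := 2 * (2 * C))
      fun p => ?_
    refine ((H p.1).le_opNorm_of_le le_rfl).trans ?_
    have := linear_mul_le_quadratic hC0 ‖p.1‖ ‖p.1‖
    have h2 := hC p.1
    calc ‖H p.1‖ * ‖p.1‖ ≤ C * (1 + ‖p.1‖) * ‖p.1‖ := by gcongr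
      _ ≤ _ := this
      _ ≤ _ := by nlinarith [mul_nonneg hC0 (sq_nonneg ‖p.2‖)]
  have hi2 : Integrable (fun q : E × E => H q.1 q.2) ((stdGaussian E).prod (stdGaussian E)) := by
    refine integrable_prod_stdGaussian_of_norm_le hm2.aestronglyMeasurable (C := 2 * C)
      fun p => ?_
    refine ((H p.1).le_opNorm_of_le le_rfl).trans ?_
    have := linear_mul_le_quadratic hC0 ‖p.1‖ ‖p.2‖
    have h2 := hC p.1
    calc ‖H p.1‖ * ‖p.2‖ ≤ C * (1 + ‖p.1‖) * ‖p.2‖ := by gcongr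
      _ ≤ _ := this
  simp_rw [hpt]
  rw [← integral_map (μ := (stdGaussian E).prod (stdGaussian E))
    (f := fun q : E × E => Real.sin θ • H q.1 q.1 + Real.cos θ • H q.1 q.2) (by fun_prop)
    ((hm1.const_smul _).add (hm2.const_smul _)).aestronglyMeasurable, hrot]
  rw [integral_add (hi1.fun_smul _) (hi2.fun_smul _), integral_smul, integral_smul]
  have hz : ∫ q : E × E, H q.1 q.2 ∂((stdGaussian E).prod (stdGaussian E)) = 0 := by
    rw [integral_prod _ hi2]
    refine integral_eq_zero_of_ae (ae_of_all _ fun x => ?_)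
    dsimp only
    have := (H x).integral_comp_comm (φ := fun y : E => y) (μ := stdGaussian E)
      IsGaussian.integrable_id
    rw [this, integral_id_stdGaussian, map_zero]
    rfl
  rw [hz, smul_zero, add_zero, integral_fun_fst (fun x => H x x)]
  simp

/-- The finite difference form of Stein's identity. Since `σ x + ε y` has the law of
`√(σ² + ε²) w`, the difference quotient is exactly a Gaussian average at a slightly larger
scale, and continuity under dilation gives the limit. No derivative of `H` is involved, so `H` may
be merely measurable. -/
lemma tendsto_integral_finiteDiff_stdGaussian [CompleteSpace V] {H : E → E →L[ℝ] V}
    (hH : StronglyMeasurable H) {C : ℝ} (hC : ∀ x, ‖H x‖ ≤ C * (1 + ‖x‖)) {σ : ℝ}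
    (hσ : 0 < σ) :
    (∀ ε : ℝ, Integrable (fun p : E × E => (H (σ • p.1 + ε • p.2) - H (σ • p.1)) (σ ^ 2 • p.2))
      ((stdGaussian E).prod (stdGaussian E))) ∧
    Tendsto (fun ε : ℝ => (1 / ε) • ∫ p : E × E,
        (H (σ • p.1 + ε • p.2) - H (σ • p.1)) (σ ^ 2 • p.2)
        ∂((stdGaussian E).prod (stdGaussian E)))
      (𝓝[>] 0) (𝓝 (∫ w, H (σ • w) (σ • w) ∂(stdGaussian E))) := by
  have hC0 : 0 ≤ C := by simpa using (norm_nonneg _).trans (hC 0)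
  -- the scaled map keeps linear growth
  have hscale (s : ℝ) (hs : 0 ≤ s) (x : E) : ‖H (s • x)‖ ≤ C * (1 + s) * (1 + ‖x‖) := by
    refine (hC _).trans ?_
    rw [norm_smul, Real.norm_of_nonneg hs]
    have : 0 ≤ ‖x‖ := norm_nonneg x
    rw [mul_assoc]
    gcongr
    nlinarith
  have hmeas (ε : ℝ) : StronglyMeasurable fun p : E × E => H (σ • p.1 + ε • p.2) (σ ^ 2 • p.2) :=
    stronglyMeasurable_clm_apply (hH.comp_measurable (by fun_prop)) (by fun_prop)
  have hint (ε : ℝ) : Integrable (fun p : E × E => H (σ • p.1 + ε • p.2) (σ ^ 2 • p.2))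
      ((stdGaussian E).prod (stdGaussian E)) := by
    refine integrable_prod_stdGaussian_of_norm_le (hmeas ε).aestronglyMeasurable
      (C := C * (1 + σ + |ε|) * 2 * σ ^ 2) fun p => ?_
    refine ((H _).le_opNorm_of_le le_rfl).trans ?_
    have h1 : ‖σ • p.1 + ε • p.2‖ ≤ σ * ‖p.1‖ + |ε| * ‖p.2‖ := by
      refine (norm_add_le _ _).trans (le_of_eq ?_)
      rw [norm_smul, norm_smul, Real.norm_of_nonneg hσ.le, Real.norm_eq_abs]
    have h2 : ‖σ ^ 2 • p.2‖ = σ ^ 2 * ‖p.2‖ := by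
      rw [norm_smul, Real.norm_of_nonneg (by positivity)]
    rw [h2]
    have ha := norm_nonneg p.1
    have hb := norm_nonneg p.2
    have he := abs_nonneg ε
    have h3 : (1 + (σ * ‖p.1‖ + |ε| * ‖p.2‖)) * ‖p.2‖
        ≤ (1 + σ + |ε|) * 2 * (1 + ‖p.1‖ ^ 2 + ‖p.2‖ ^ 2) := by
      nlinarith [sq_nonneg (‖p.2‖ - 1), mul_nonneg hσ.le (sq_nonneg (‖p.1‖ - ‖p.2‖)),
        mul_nonneg hσ.le (sq_nonneg ‖p.1‖), mul_nonneg hσ.le (sq_nonneg ‖p.2‖),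
        mul_nonneg he (sq_nonneg ‖p.1‖), mul_nonneg he (sq_nonneg ‖p.2‖),
        sq_nonneg ‖p.1‖, sq_nonneg ‖p.2‖]
    calc ‖H (σ • p.1 + ε • p.2)‖ * (σ ^ 2 * ‖p.2‖)
        ≤ C * (1 + (σ * ‖p.1‖ + |ε| * ‖p.2‖)) * (σ ^ 2 * ‖p.2‖) := by
          gcongr
          exact (hC _).trans (by gcongr)
      _ = C * σ ^ 2 * ((1 + (σ * ‖p.1‖ + |ε| * ‖p.2‖)) * ‖p.2‖) := by ring
      _ ≤ C * σ ^ 2 * ((1 + σ + |ε|) * 2 * (1 + ‖p.1‖ ^ 2 + ‖p.2‖ ^ 2)) := by gcongr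
      _ = _ := by ring
  have hint0 : Integrable (fun p : E × E => H (σ • p.1) (σ ^ 2 • p.2))
      ((stdGaussian E).prod (stdGaussian E)) := by simpa using hint 0
  refine ⟨fun ε => ((hint ε).sub hint0).congr (ae_of_all _ fun p => rfl), ?_⟩
  have hform (ε : ℝ) : ∫ p : E × E, H (σ • p.1 + ε • p.2) (σ ^ 2 • p.2)
        ∂((stdGaussian E).prod (stdGaussian E))
      = (σ ^ 2 * ε / (σ ^ 2 + ε ^ 2)) •
        ∫ w, H (√(σ ^ 2 + ε ^ 2) • w) (√(σ ^ 2 + ε ^ 2) • w) ∂(stdGaussian E) := by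
    set s := √(σ ^ 2 + ε ^ 2) with hs
    have hs0 : 0 < s := Real.sqrt_pos.2 (by positivity)
    have hs2 : s ^ 2 = σ ^ 2 + ε ^ 2 := Real.sq_sqrt (by positivity)
    have hsq : √(1 + (ε / σ) ^ 2) = s / σ := by
      rw [Real.sqrt_eq_iff_mul_self_eq (by positivity) (by positivity)]
      field_simp
      linarith
    -- `θ = arctan (ε / σ)` is the angle with `s (cos θ, sin θ) = (σ, ε)`
    have hcos : s * Real.cos (Real.arctan (ε / σ)) = σ := by
      rw [Real.cos_arctan, hsq]; field_simp
    have hsin : s * Real.sin (Real.arctan (ε / σ)) = ε := by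
      rw [Real.sin_arctan, hsq]; field_simp
    have key := integral_rotation_stdGaussian (H := fun x => H (s • x))
      (hH.comp_measurable (by fun_prop)) (hscale s hs0.le) (Real.arctan (ε / σ))
    simp_rw [smul_add, smul_smul, hcos, hsin] at key
    simp_rw [map_smul, integral_smul, smul_smul]
    rw [key, smul_smul]
    congr 1
    rw [← hs2]
    field_simp
    linarith
  have hzero : ∫ p : E × E, H (σ • p.1) (σ ^ 2 • p.2)
      ∂((stdGaussian E).prod (stdGaussian E)) = 0 := by
    simpa using hform 0
  have hdil := tendsto_integral_smul_stdGaussian (g := fun x => H x x)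
    (stronglyMeasurable_clm_apply hH (by fun_prop)) (C := 2 * (2 * C)) (fun x => by
      have := linear_mul_le_quadratic hC0 ‖x‖ ‖x‖
      have h2 := hC x
      calc ‖H x x‖ ≤ ‖H x‖ * ‖x‖ := (H x).le_opNorm x
        _ ≤ C * (1 + ‖x‖) * ‖x‖ := by gcongr
        _ ≤ _ := this
        _ ≤ _ := by nlinarith) hσ
  have hsqrt : Tendsto (fun ε : ℝ => √(σ ^ 2 + ε ^ 2)) (𝓝[>] 0) (𝓝 σ) := by
    have : ContinuousAt (fun ε : ℝ => √(σ ^ 2 + ε ^ 2)) 0 := by fun_prop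
    have h := this.tendsto
    simp only [ne_eq, OfNat.ofNat_ne_zero, not_false_eq_true, zero_pow, add_zero,
      Real.sqrt_sq hσ.le] at h
    exact h.mono_left nhdsWithin_le_nhds
  have hcoef : Tendsto (fun ε : ℝ => σ ^ 2 / (σ ^ 2 + ε ^ 2)) (𝓝[>] 0) (𝓝 1) := by
    have : ContinuousAt (fun ε : ℝ => σ ^ 2 / (σ ^ 2 + ε ^ 2)) 0 := by
      have h0 : σ ^ 2 + (0 : ℝ) ^ 2 ≠ 0 := by positivity
      fun_prop (disch := assumption)
    have h := this.tendsto
    simp only [ne_eq, OfNat.ofNat_ne_zero, not_false_eq_true, zero_pow, add_zero,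
      div_self (pow_ne_zero 2 hσ.ne')] at h
    exact h.mono_left nhdsWithin_le_nhds
  have hlim := hcoef.smul (hdil.comp hsqrt)
  rw [one_smul] at hlim
  refine hlim.congr' ?_
  filter_upwards [self_mem_nhdsWithin] with ε hε
  have hε : 0 < ε := hε
  simp_rw [sub_apply]
  rw [integral_sub (hint ε) hint0, hzero, sub_zero, hform ε, smul_smul]
  congr 1
  field_simp

end GaussianIntegration

/-! ### Weak gradients of locally Lipschitz functions -/

section WeakGradient

variable {L : ℕ}

/-- A function which is Lipschitz on balls has its almost everywhere defined classical gradient as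
weak gradient: on the support of a test function it agrees with a globally Lipschitz function, to
which integration by parts for Lipschitz functions applies. -/
lemma hasWeakGradient_of_lipschitzOn_balls {f : Euc L → ℝ} {g : Euc L → Euc L}
    (hf : ∀ r : ℝ, ∃ C : ℝ≥0, LipschitzOnWith C f (Metric.ball 0 r))
    (hg : ∀ᵐ x, HasGradientAt f (g x) x) : HasWeakGradient f g := by
  have hcont : Continuous f := by
    refine continuous_iff_continuousAt.2 fun x => ?_
    obtain ⟨C, hC⟩ := hf (‖x‖ + 1)
    exact hC.continuousOn.continuousAt (Metric.isOpen_ball.mem_nhds (by simp))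
  refine ⟨hcont.locallyIntegrable, ?_, ?_⟩
  · have hmeas : AEStronglyMeasurable g := by
      have h : Measurable fun x => gradient f x :=
        (InnerProductSpace.toDual ℝ (Euc L)).symm.continuous.measurable.comp
          (measurable_fderiv ℝ f)
      exact h.aestronglyMeasurable.congr (hg.mono fun x hx => hx.gradient)
    refine (locallyIntegrable_iff).2 fun K hK => ?_
    obtain ⟨r, hr⟩ := hK.isBounded.subset_ball 0
    obtain ⟨C, hC⟩ := hf r
    refine Measure.integrableOn_of_bounded (M := C) hK.measure_lt_top.ne hmeas ?_
    filter_upwards [ae_restrict_of_ae hg, ae_restrict_mem hK.measurableSet] with x hx hxK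
    have hle := hx.hasFDerivAt.le_of_lipschitzOn (Metric.isOpen_ball.mem_nhds (hr hxK)) hC
    simpa using hle
  · intro φ hφ hφc v
    obtain ⟨r, hr⟩ := hφc.isCompact.isBounded.subset_ball 0
    obtain ⟨C, hC⟩ := hf r
    obtain ⟨F, hF, hfF⟩ := hC.extend_real
    have hφ1 : ContDiff ℝ 1 φ := hφ.of_le (by exact_mod_cast le_top)
    obtain ⟨D, hD⟩ := hφ1.lipschitzWith_of_hasCompactSupport hφc one_ne_zero
    have hparts := hF.integral_lineDeriv_mul_eq (μ := volume) hD hφc v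
    have hout {x : Euc L} (hx : x ∉ Metric.ball (0 : Euc L) r) : x ∉ tsupport φ :=
      fun h => hx (hr h)
    have hleft : ∫ x, lineDeriv ℝ F x v * φ x = ∫ x, inner ℝ (g x) v * φ x := by
      refine integral_congr_ae ?_
      filter_upwards [hg] with x hx
      by_cases hmem : x ∈ Metric.ball (0 : Euc L) r
      · have heq : F =ᶠ[𝓝 x] f :=
          (hfF.eventuallyEq_of_mem (Metric.isOpen_ball.mem_nhds hmem)).symm
        have hFx := hx.hasFDerivAt.congr_of_eventuallyEq heq
        rw [hFx.hasLineDerivAt v |>.lineDeriv]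
        simp
      · simp [image_eq_zero_of_notMem_tsupport (hout hmem)]
    have hright : ∫ x, lineDeriv ℝ φ x (-v) * F x = - ∫ x, f x * fderiv ℝ φ x v := by
      rw [← integral_neg]
      refine integral_congr_ae (ae_of_all _ fun x => ?_)
      dsimp only
      rw [((hφ1.differentiable one_ne_zero) x).lineDeriv_eq_fderiv, map_neg]
      by_cases hmem : x ∈ Metric.ball (0 : Euc L) r
      · rw [hfF hmem]; ring
      · have : fderiv ℝ φ x = 0 :=
          image_eq_zero_of_notMem_tsupport fun h => hout hmem (tsupport_fderiv_subset ℝ h)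
        simp [this]
    rw [hleft, hright] at hparts
    rw [hparts, neg_neg]

end WeakGradient

/-! ### Regularity of the estimator and of the averaged SURE in the hyperparameters -/

section Estimator

variable {N L : ℕ} {uhat : Euc N → Euc L → Euc N} {K₁ : Euc L → ℝ≥0} {K₂ : ℝ≥0}

lemma continuous_estimator (hLip_z : ∀ Θ, LipschitzWith (K₁ Θ) (fun z => uhat z Θ))
    (hLip_Θ : ∀ z, LipschitzWith K₂ (fun Θ => uhat z Θ)) :
    Continuous (Function.uncurry uhat) :=
  continuous_prod_of_continuous_lipschitzWith' _ K₂ hLip_Θ fun Θ => (hLip_z Θ).continuous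

lemma norm_estimator_le (hLip_z : ∀ Θ, LipschitzWith (K₁ Θ) (fun z => uhat z Θ))
    (h_zero : ∀ Θ, uhat 0 Θ = 0) (z : Euc N) (Θ : Euc L) : ‖uhat z Θ‖ ≤ K₁ Θ * ‖z‖ := by
  simpa [h_zero] using (hLip_z Θ).norm_sub_le z 0

lemma norm_jacobian_le (hLip_Θ : ∀ z, LipschitzWith K₂ (fun Θ => uhat z Θ))
    (z : Euc N) (Θ : Euc L) : ‖jacobian uhat z Θ‖ ≤ K₂ :=
  norm_fderiv_le_of_lipschitz ℝ (hLip_Θ z)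

lemma stronglyMeasurable_adjoint_jacobian (hu : Continuous (Function.uncurry uhat)) (Θ : Euc L) :
    StronglyMeasurable fun z => (jacobian uhat z Θ).adjoint := by
  have h : Measurable fun z => jacobian uhat z Θ :=
    (measurable_fderiv_with_param ℝ hu).comp (by fun_prop : Measurable fun z : Euc N => (z, Θ))
  exact ContinuousLinearMap.adjoint.isometry.continuous.comp_stronglyMeasurable h.stronglyMeasurable

lemma norm_adjoint_jacobian_le (hLip_Θ : ∀ z, LipschitzWith K₂ (fun Θ => uhat z Θ))
    (z : Euc N) (Θ : Euc L) : ‖(jacobian uhat z Θ).adjoint‖ ≤ K₂ := by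
  rw [LinearIsometryEquiv.norm_map]
  exact norm_jacobian_le hLip_Θ z Θ

lemma hasGradientAt_sq_norm_estimator_sub {z : Euc N} {Θ : Euc L}
    (h : DifferentiableAt ℝ (fun Θ' => uhat z Θ') Θ) (c : Euc N) :
    HasGradientAt (fun Θ' => ‖uhat z Θ' - c‖ ^ 2)
      ((2 : ℝ) • (jacobian uhat z Θ).adjoint (uhat z Θ - c)) Θ := by
  rw [hasGradientAt_iff_hasFDerivAt]
  refine (h.hasFDerivAt.sub_const c).norm_sq.congr_fderiv ?_
  ext v
  simp [jacobian, ContinuousLinearMap.adjoint_inner_left]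

lemma hasGradientAt_inner_estimator_sub {z z' : Euc N} {Θ : Euc L}
    (h : DifferentiableAt ℝ (fun Θ' => uhat z Θ') Θ)
    (h' : DifferentiableAt ℝ (fun Θ' => uhat z' Θ') Θ) (c : Euc N) :
    HasGradientAt (fun Θ' => inner ℝ (uhat z' Θ' - uhat z Θ') c)
      ((jacobian uhat z' Θ - jacobian uhat z Θ).adjoint c) Θ := by
  rw [hasGradientAt_iff_hasFDerivAt]
  refine ((h'.hasFDerivAt.sub h.hasFDerivAt).inner ℝ (hasFDerivAt_const c Θ)).congr_fderiv ?_
  ext v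
  simp [jacobian, ContinuousLinearMap.adjoint_inner_left, inner_sub_left, real_inner_comm]

/-- The Lipschitz modulus of the squared loss on a ball, with an explicit dependence on `z` which
is integrable against Gaussian laws. -/
lemma abs_sq_norm_estimator_sub_le (hLip_Θ : ∀ z, LipschitzWith K₂ (fun Θ => uhat z Θ))
    (z c : Euc N) {r : ℝ} {Θ Θ' : Euc L} (h : Θ ∈ Metric.ball (0 : Euc L) r)
    (h' : Θ' ∈ Metric.ball (0 : Euc L) r) :
    |‖uhat z Θ - c‖ ^ 2 - ‖uhat z Θ' - c‖ ^ 2|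
      ≤ 2 * K₂ * (‖uhat z 0 - c‖ + K₂ * r) * ‖Θ - Θ'‖ := by
  have hb {T : Euc L} (hT : T ∈ Metric.ball (0 : Euc L) r) :
      ‖uhat z T - c‖ ≤ ‖uhat z 0 - c‖ + K₂ * r := by
    have h1 := (hLip_Θ z).norm_sub_le T 0
    have h2 : ‖T - 0‖ ≤ r := by simpa using (mem_ball_zero_iff.1 hT).le
    calc ‖uhat z T - c‖ = ‖(uhat z 0 - c) + (uhat z T - uhat z 0)‖ := by congr 1; abel
      _ ≤ _ := norm_add_le _ _
      _ ≤ _ := by gcongr; exact h1.trans (by gcongr)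
  have hd : |‖uhat z Θ - c‖ - ‖uhat z Θ' - c‖| ≤ K₂ * ‖Θ - Θ'‖ := by
    refine (abs_norm_sub_norm_le _ _).trans ?_
    rw [sub_sub_sub_cancel_right]
    exact (hLip_Θ z).norm_sub_le Θ Θ'
  rw [sq_sub_sq, abs_mul, abs_of_nonneg (by positivity)]
  calc _ ≤ (2 * (‖uhat z 0 - c‖ + K₂ * r)) * (K₂ * ‖Θ - Θ'‖) := by
        refine mul_le_mul ?_ hd (abs_nonneg _) ?_
        · linarith [hb h, hb h']
        · linarith [hb h, norm_nonneg (uhat z Θ - c)]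
    _ = _ := by ring

end Estimator

section AveragedSure

variable {N L R : ℕ} {uhat : Euc N → Euc L → Euc N} {K₂ : ℝ≥0}

lemma hasGradientAt_avgSure {σ ε : ℝ} {z : Euc N} {D : Fin R → Euc N} {Θ : Euc L}
    (h : DifferentiableAt ℝ (fun Θ' => uhat z Θ') Θ)
    (hD : ∀ r, DifferentiableAt ℝ (fun Θ' => uhat (z + ε • D r) Θ') Θ) :
    HasGradientAt (avgSure uhat σ ε D z) (avgSugar uhat σ ε D z Θ) Θ := by
  have hr (r : Fin R) : HasGradientAt (fun Θ' => fdmcSure uhat σ ε (D r) z Θ')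
      (fdmcSugar uhat σ ε (D r) z Θ) Θ := by
    have h1 := hasGradientAt_iff_hasFDerivAt.1 (hasGradientAt_sq_norm_estimator_sub h z)
    have h2 := hasGradientAt_iff_hasFDerivAt.1
      (hasGradientAt_inner_estimator_sub h (hD r) (σ ^ 2 • D r))
    rw [hasGradientAt_iff_hasFDerivAt]
    refine ((h1.add (h2.const_mul (2 / ε))).sub_const (σ ^ 2 * (N : ℝ))).congr_fderiv ?_
    ext v
    simp [fdmcSugar]
  rw [hasGradientAt_iff_hasFDerivAt]
  refine ((HasFDerivAt.fun_sum (u := Finset.univ) fun r _ =>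
    hasGradientAt_iff_hasFDerivAt.1 (hr r)).const_mul (1 / (R : ℝ))).congr_fderiv ?_
  ext v
  simp [avgSugar]

lemma lipschitzOn_ball_avgSure (hLip_Θ : ∀ z, LipschitzWith K₂ (fun Θ => uhat z Θ))
    (σ ε : ℝ) (z : Euc N) (D : Fin R → Euc N) (r : ℝ) :
    ∃ C : ℝ≥0, LipschitzOnWith C (avgSure uhat σ ε D z) (Metric.ball 0 r) := by
  set B : Fin R → ℝ := fun i => 2 * K₂ * (‖uhat z 0 - z‖ + K₂ * r)
    + |2 / ε| * ((2 * K₂) * ‖σ ^ 2 • D i‖) with hB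
  refine ⟨Real.toNNReal (|1 / (R : ℝ)| * ∑ i, B i), LipschitzOnWith.of_dist_le_mul ?_⟩
  intro Θ h Θ' h'
  rw [Real.dist_eq, dist_eq_norm]
  have hterm (i : Fin R) : |fdmcSure uhat σ ε (D i) z Θ - fdmcSure uhat σ ε (D i) z Θ'|
      ≤ B i * ‖Θ - Θ'‖ := by
    have h1 := abs_sq_norm_estimator_sub_le hLip_Θ z z h h'
    have h2 : |(inner ℝ (uhat (z + ε • D i) Θ - uhat z Θ) (σ ^ 2 • D i) : ℝ)
        - inner ℝ (uhat (z + ε • D i) Θ' - uhat z Θ') (σ ^ 2 • D i)|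
        ≤ (2 * K₂ * ‖Θ - Θ'‖) * ‖σ ^ 2 • D i‖ := by
      rw [← inner_sub_left]
      refine (abs_real_inner_le_norm _ _).trans ?_
      gcongr
      have ha := (hLip_Θ (z + ε • D i)).norm_sub_le Θ Θ'
      have hb := (hLip_Θ z).norm_sub_le Θ Θ'
      calc _ = ‖(uhat (z + ε • D i) Θ - uhat (z + ε • D i) Θ') - (uhat z Θ - uhat z Θ')‖ := by
            congr 1; abel
        _ ≤ _ := norm_sub_le _ _
        _ ≤ _ := by linarith
    calc _ = |(‖uhat z Θ - z‖ ^ 2 - ‖uhat z Θ' - z‖ ^ 2) + (2 / ε) *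
          ((inner ℝ (uhat (z + ε • D i) Θ - uhat z Θ) (σ ^ 2 • D i) : ℝ)
            - inner ℝ (uhat (z + ε • D i) Θ' - uhat z Θ') (σ ^ 2 • D i))| := by
          unfold fdmcSure; congr 1; ring
      _ ≤ 2 * K₂ * (‖uhat z 0 - z‖ + K₂ * r) * ‖Θ - Θ'‖
          + |2 / ε| * ((2 * K₂ * ‖Θ - Θ'‖) * ‖σ ^ 2 • D i‖) := by
          refine (abs_add_le _ _).trans ?_
          rw [abs_mul]
          gcongr
      _ = _ := by rw [hB]; ring
  calc |avgSure uhat σ ε D z Θ - avgSure uhat σ ε D z Θ'|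
      = |1 / (R : ℝ)| * |∑ i, (fdmcSure uhat σ ε (D i) z Θ - fdmcSure uhat σ ε (D i) z Θ')| := by
        unfold avgSure
        rw [← mul_sub, abs_mul, Finset.sum_sub_distrib]
    _ ≤ |1 / (R : ℝ)| * ∑ i, B i * ‖Θ - Θ'‖ := by
        gcongr
        exact (Finset.abs_sum_le_sum_abs _ _).trans (Finset.sum_le_sum fun i _ => hterm i)
    _ = (|1 / (R : ℝ)| * ∑ i, B i) * ‖Θ - Θ'‖ := by rw [← Finset.sum_mul, mul_assoc]
    _ ≤ _ := by gcongr; exact Real.le_coe_toNNReal _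

lemma ae_hasGradientAt_avgSure (hLip_Θ : ∀ z, LipschitzWith K₂ (fun Θ => uhat z Θ))
    (σ ε : ℝ) (z : Euc N) (D : Fin R → Euc N) :
    ∀ᵐ Θ, HasGradientAt (avgSure uhat σ ε D z) (avgSugar uhat σ ε D z Θ) Θ := by
  filter_upwards [(hLip_Θ z).ae_differentiableAt (μ := volume),
    ae_all_iff.2 fun r => (hLip_Θ (z + ε • D r)).ae_differentiableAt (μ := volume)] with Θ h hD
  exact hasGradientAt_avgSure h hD

end AveragedSure

/-! ### Expectations over the observation and the probe vectors -/

lemma integrable_comp_of_hasLaw {Ω α F : Type*} [MeasurableSpace Ω] [MeasurableSpace α]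
    [NormedAddCommGroup F] {P : Measure Ω} {μ : Measure α} {X : Ω → α} (hX : HasLaw X μ P)
    {f : α → F} (hf : Integrable f μ) : Integrable (fun ω => f (X ω)) P := by
  rw [← hX.map_eq] at hf
  exact hf.comp_aemeasurable hX.aemeasurable

lemma integrable_inner_of_memLp_two {α E : Type*} [MeasurableSpace α] [NormedAddCommGroup E]
    [InnerProductSpace ℝ E] {μ : Measure α} {f g : α → E} (hf : MemLp f 2 μ) (hg : MemLp g 2 μ) :
    Integrable (fun x => (inner ℝ (f x) (g x) : ℝ)) μ :=
  (hf.norm.integrable_mul hg.norm).mono' (hf.1.inner hg.1)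
    (ae_of_all _ fun _ => norm_inner_le_norm _ _)

section Risk

variable {N L : ℕ} {uhat : Euc N → Euc L → Euc N} {K₁ : Euc L → ℝ≥0} {K₂ : ℝ≥0}

/-- Linear growth of the estimator along `x ↦ ū + x`. -/
lemma norm_estimator_add_le (hLip_z : ∀ Θ, LipschitzWith (K₁ Θ) (fun z => uhat z Θ))
    (h_zero : ∀ Θ, uhat 0 Θ = 0) (ubar : Euc N) (Θ : Euc L) (x : Euc N) :
    ‖uhat (ubar + x) Θ‖ ≤ K₁ Θ * (1 + ‖ubar‖) * (1 + ‖x‖) := by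
  refine (norm_estimator_le hLip_z h_zero _ Θ).trans ?_
  rw [mul_assoc]
  gcongr
  nlinarith [norm_add_le ubar x, norm_nonneg ubar, norm_nonneg x,
    mul_nonneg (norm_nonneg ubar) (norm_nonneg x)]

lemma memLp_two_id_stdGaussian_scaled (ubar : Euc N) (σ : ℝ) :
    MemLp (fun x : Euc N => ubar + σ • x) 2 (stdGaussian (Euc N)) :=
  (memLp_const ubar).add (IsGaussian.memLp_two_id.const_smul σ)

lemma memLp_two_estimator (hLip_z : ∀ Θ, LipschitzWith (K₁ Θ) (fun z => uhat z Θ))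
    (h_zero : ∀ Θ, uhat 0 Θ = 0) (ubar : Euc N) (σ : ℝ) (Θ : Euc L) :
    MemLp (fun x => uhat (ubar + σ • x) Θ) 2 (stdGaussian (Euc N)) := by
  refine (memLp_two_id_stdGaussian_scaled ubar σ).of_le_mul (c := K₁ Θ) ?_
    (ae_of_all _ fun x => norm_estimator_le hLip_z h_zero _ Θ)
  exact ((hLip_z Θ).continuous.comp (by fun_prop)).aestronglyMeasurable

/-- The Monte Carlo divergence term has the correct expectation in the limit, so that the finite
difference SURE is asymptotically unbiased for the risk, for one probe vector. -/
lemma fdmcSure_asymptotically_unbiased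
    (hLip_z : ∀ Θ, LipschitzWith (K₁ Θ) (fun z => uhat z Θ))
    (h_zero : ∀ Θ, uhat 0 Θ = 0) (ubar : Euc N) {σ : ℝ} (hσ : 0 < σ) (Θ : Euc L) :
    (∀ ε : ℝ, Integrable
      (fun p : Euc N × Euc N => fdmcSure uhat σ ε p.2 (ubar + σ • p.1) Θ)
      ((stdGaussian (Euc N)).prod (stdGaussian (Euc N)))) ∧
    Tendsto (fun ε : ℝ => ∫ p : Euc N × Euc N, fdmcSure uhat σ ε p.2 (ubar + σ • p.1) Θ
        ∂((stdGaussian (Euc N)).prod (stdGaussian (Euc N))))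
      (𝓝[>] 0) (𝓝 (∫ x, ‖uhat (ubar + σ • x) Θ - ubar‖ ^ 2 ∂(stdGaussian (Euc N)))) := by
  set γ := stdGaussian (Euc N) with hγ
  have hu := (hLip_z Θ).continuous
  set H : Euc N → Euc N →L[ℝ] ℝ := fun x => innerSL ℝ (uhat (ubar + x) Θ) with hH
  obtain ⟨hTint, hTlim⟩ := tendsto_integral_finiteDiff_stdGaussian (H := H)
    ((innerSL ℝ).continuous.comp (hu.comp (by fun_prop))).stronglyMeasurable
    (C := K₁ Θ * (1 + ‖ubar‖)) (fun x => by
      rw [hH, innerSL_apply_norm]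
      exact norm_estimator_add_le hLip_z h_zero ubar Θ x) hσ
  have hmem := memLp_two_estimator hLip_z h_zero ubar σ Θ
  have hres : Integrable (fun x => ‖uhat (ubar + σ • x) Θ - (ubar + σ • x)‖ ^ 2) γ :=
    (hmem.sub (memLp_two_id_stdGaussian_scaled ubar σ)).integrable_norm_pow'
  have hres2 : Integrable
      (fun p : Euc N × Euc N => ‖uhat (ubar + σ • p.1) Θ - (ubar + σ • p.1)‖ ^ 2)
      (γ.prod γ) := hres.comp_fst γ
  have hform (ε : ℝ) (p : Euc N × Euc N) : fdmcSure uhat σ ε p.2 (ubar + σ • p.1) Θ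
      = ‖uhat (ubar + σ • p.1) Θ - (ubar + σ • p.1)‖ ^ 2
        + (2 / ε) * (H (σ • p.1 + ε • p.2) - H (σ • p.1)) (σ ^ 2 • p.2) - σ ^ 2 * (N : ℝ) := by
    simp only [fdmcSure, hH, sub_apply, innerSL_apply_apply, inner_sub_left, add_assoc]
  simp_rw [hform]
  refine ⟨fun ε => (hres2.add ((hTint ε).const_mul _)).sub (integrable_const _), ?_⟩
  have hval (ε : ℝ) : ∫ p : Euc N × Euc N,
        (‖uhat (ubar + σ • p.1) Θ - (ubar + σ • p.1)‖ ^ 2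
        + (2 / ε) * (H (σ • p.1 + ε • p.2) - H (σ • p.1)) (σ ^ 2 • p.2) - σ ^ 2 * (N : ℝ))
        ∂(γ.prod γ)
      = ∫ x, ‖uhat (ubar + σ • x) Θ - (ubar + σ • x)‖ ^ 2 ∂γ
        + 2 * ((1 / ε) • ∫ p : Euc N × Euc N,
          (H (σ • p.1 + ε • p.2) - H (σ • p.1)) (σ ^ 2 • p.2) ∂(γ.prod γ))
        - σ ^ 2 * (N : ℝ) := by
    rw [integral_sub (hres2.fun_add ((hTint ε).const_mul _)) (integrable_const _),
      integral_add hres2 ((hTint ε).const_mul _), integral_const_mul,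
      integral_fun_fst (fun x => ‖uhat (ubar + σ • x) Θ - (ubar + σ • x)‖ ^ 2)]
    simp only [smul_eq_mul, integral_const, probReal_univ, one_mul]
    ring
  simp_rw [hval]
  have hlim := (tendsto_const_nhds (x := ∫ x, ‖uhat (ubar + σ • x) Θ - (ubar + σ • x)‖ ^ 2 ∂γ)).add
    (hTlim.const_mul 2) |>.sub_const (σ ^ 2 * (N : ℝ))
  convert hlim using 2
  -- expand the square of `û - ū = (û - z) + σ ζ`
  have hcross : Integrable (fun x => H (σ • x) (σ • x)) γ :=
    integrable_inner_of_memLp_two hmem (IsGaussian.memLp_two_id.const_smul σ)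
  have hmean : Integrable (fun x : Euc N => inner ℝ ubar (σ • x)) γ :=
    integrable_inner_of_memLp_two (memLp_const ubar) (IsGaussian.memLp_two_id.const_smul σ)
  have hmean0 : ∫ x : Euc N, inner ℝ ubar (σ • x) ∂γ = 0 := by
    simp_rw [inner_smul_right]
    rw [integral_const_mul, integral_inner (f := fun x : Euc N => x)
      (IsGaussian.integrable_id (μ := γ)) ubar]
    simp [hγ]
  have hpt (x : Euc N) : ‖uhat (ubar + σ • x) Θ - ubar‖ ^ 2
      = ‖uhat (ubar + σ • x) Θ - (ubar + σ • x)‖ ^ 2 + 2 * H (σ • x) (σ • x)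
        - 2 * inner ℝ ubar (σ • x) - σ ^ 2 * ‖x‖ ^ 2 := by
    have h := norm_add_sq_real (uhat (ubar + σ • x) Θ - (ubar + σ • x)) (σ • x)
    rw [show uhat (ubar + σ • x) Θ - (ubar + σ • x) + σ • x = uhat (ubar + σ • x) Θ - ubar by
      abel] at h
    rw [h, hH]
    simp only [innerSL_apply_apply, inner_sub_left, inner_add_left, norm_smul, mul_pow,
      Real.norm_eq_abs, sq_abs, real_inner_self_eq_norm_sq]
    ring
  simp_rw [hpt]
  have hsub : Integrable (fun x => ‖uhat (ubar + σ • x) Θ - (ubar + σ • x)‖ ^ 2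
      + 2 * H (σ • x) (σ • x) - 2 * inner ℝ ubar (σ • x)) γ :=
    (hres.add (hcross.const_mul 2)).sub (hmean.const_mul 2)
  rw [integral_sub hsub ((integrable_norm_pow_stdGaussian 2).const_mul _),
    integral_sub (hres.fun_add (hcross.const_mul 2)) (hmean.const_mul 2),
    integral_add hres (hcross.const_mul 2), integral_const_mul, integral_const_mul,
    integral_const_mul, hmean0, hγ, integral_norm_sq_stdGaussian]
  simp

/-- The Gaussian average of `2 ∂_Θ û^* (û - ū)` is the limiting expectation of the finite
difference SUGAR, for one probe vector. This holds at every `Θ`, with the Jacobian read as zero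
where it does not exist; differentiability of the estimator
is only needed to identify the average with the gradient of the risk. -/
lemma fdmcSugar_asymptotically_unbiased
    (hLip_z : ∀ Θ, LipschitzWith (K₁ Θ) (fun z => uhat z Θ))
    (hLip_Θ : ∀ z, LipschitzWith K₂ (fun Θ => uhat z Θ))
    (h_zero : ∀ Θ, uhat 0 Θ = 0) (ubar : Euc N) {σ : ℝ} (hσ : 0 < σ) (Θ : Euc L) :
    (∀ ε : ℝ, Integrable
      (fun p : Euc N × Euc N => fdmcSugar uhat σ ε p.2 (ubar + σ • p.1) Θ)
      ((stdGaussian (Euc N)).prod (stdGaussian (Euc N)))) ∧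
    Tendsto (fun ε : ℝ => ∫ p : Euc N × Euc N, fdmcSugar uhat σ ε p.2 (ubar + σ • p.1) Θ
        ∂((stdGaussian (Euc N)).prod (stdGaussian (Euc N))))
      (𝓝[>] 0) (𝓝 (∫ x, (2 : ℝ) • (jacobian uhat (ubar + σ • x) Θ).adjoint
        (uhat (ubar + σ • x) Θ - ubar) ∂(stdGaussian (Euc N)))) := by
  set γ := stdGaussian (Euc N) with hγ
  have hu := (hLip_z Θ).continuous
  have hJ := stronglyMeasurable_adjoint_jacobian (continuous_estimator hLip_z hLip_Θ) Θ
  set H : Euc N → Euc N →L[ℝ] Euc L := fun x => (jacobian uhat (ubar + x) Θ).adjoint with hH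
  have hHm : StronglyMeasurable H := hJ.comp_measurable (by fun_prop)
  obtain ⟨hTint, hTlim⟩ := tendsto_integral_finiteDiff_stdGaussian (H := H) hHm
    (C := K₂) (fun x => by
      refine (norm_adjoint_jacobian_le hLip_Θ _ Θ).trans ?_
      have := norm_nonneg x
      have hK := K₂.coe_nonneg
      nlinarith [mul_nonneg hK this]) hσ
  -- the adjoint Jacobian is bounded, so it preserves square integrability
  have hpair {v : Euc N → Euc N} (hv : MemLp v 2 γ) :
      Integrable (fun x => H (σ • x) (v x)) γ := by
    refine MemLp.integrable (q := 2) (by norm_num) (hv.of_le_mul (c := K₂) ?_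
      (ae_of_all _ fun x => ?_))
    · exact isBoundedBilinearMap_apply.continuous.comp_aestronglyMeasurable
        ((hHm.comp_measurable (by fun_prop)).aestronglyMeasurable.prodMk hv.1)
    · exact (H (σ • x)).le_of_opNorm_le (norm_adjoint_jacobian_le hLip_Θ _ Θ) _
  have hmem := memLp_two_estimator hLip_z h_zero ubar σ Θ
  have hres : Integrable
      (fun x => (2 : ℝ) • H (σ • x) (uhat (ubar + σ • x) Θ - (ubar + σ • x))) γ :=
    (hpair (hmem.sub (memLp_two_id_stdGaussian_scaled ubar σ))).fun_smul _
  have hres2 : Integrable (fun p : Euc N × Euc N =>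
      (2 : ℝ) • H (σ • p.1) (uhat (ubar + σ • p.1) Θ - (ubar + σ • p.1))) (γ.prod γ) :=
    hres.comp_fst γ
  have hform (ε : ℝ) (p : Euc N × Euc N) : fdmcSugar uhat σ ε p.2 (ubar + σ • p.1) Θ
      = (2 : ℝ) • H (σ • p.1) (uhat (ubar + σ • p.1) Θ - (ubar + σ • p.1))
        + (2 / ε) • (H (σ • p.1 + ε • p.2) - H (σ • p.1)) (σ ^ 2 • p.2) := by
    simp only [fdmcSugar, hH, map_sub, add_assoc]
  simp_rw [hform]
  refine ⟨fun ε => hres2.add ((hTint ε).fun_smul _), ?_⟩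
  have hval (ε : ℝ) : ∫ p : Euc N × Euc N,
        ((2 : ℝ) • H (σ • p.1) (uhat (ubar + σ • p.1) Θ - (ubar + σ • p.1))
        + (2 / ε) • (H (σ • p.1 + ε • p.2) - H (σ • p.1)) (σ ^ 2 • p.2)) ∂(γ.prod γ)
      = ∫ x, (2 : ℝ) • H (σ • x) (uhat (ubar + σ • x) Θ - (ubar + σ • x)) ∂γ
        + (2 : ℝ) • ((1 / ε) • ∫ p : Euc N × Euc N,
          (H (σ • p.1 + ε • p.2) - H (σ • p.1)) (σ ^ 2 • p.2) ∂(γ.prod γ)) := by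
    rw [integral_add hres2 ((hTint ε).fun_smul _),
      integral_fun_fst (fun x => (2 : ℝ) • H (σ • x) (uhat (ubar + σ • x) Θ - (ubar + σ • x))),
      integral_smul (2 / ε), smul_smul, probReal_univ, one_smul]
    congr 2
    ring
  simp_rw [hval]
  have hlim := (tendsto_const_nhds
    (x := ∫ x, (2 : ℝ) • H (σ • x) (uhat (ubar + σ • x) Θ - (ubar + σ • x)) ∂γ)).add
    (hTlim.const_smul (2 : ℝ))
  convert hlim using 2
  have hcross : Integrable (fun x => H (σ • x) (σ • x)) γ :=
    hpair (IsGaussian.memLp_two_id.const_smul σ)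
  rw [← integral_smul, ← integral_add hres (hcross.fun_smul _)]
  refine integral_congr_ae (ae_of_all _ fun x => ?_)
  dsimp only
  rw [← smul_add, ← map_add]
  congr 2
  abel

lemma integrable_norm_estimator_sub (hLip_z : ∀ Θ, LipschitzWith (K₁ Θ) (fun z => uhat z Θ))
    (h_zero : ∀ Θ, uhat 0 Θ = 0) (ubar : Euc N) (σ : ℝ) (Θ : Euc L) (k : ℕ) (hk : k ≤ 2) :
    Integrable (fun x => ‖uhat (ubar + σ • x) Θ - ubar‖ ^ k) (stdGaussian (Euc N)) := by
  have h := (memLp_two_estimator hLip_z h_zero ubar σ Θ).sub (memLp_const ubar)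
  exact (h.mono_exponent (p := k) (by exact_mod_cast hk)).integrable_norm_pow'

/-- Differentiation of the risk under the expectation. Lipschitz continuity in `Θ` provides the
domination, so almost sure differentiability at the single point `Θ` suffices. -/
lemma hasGradientAt_gaussianRisk (hLip_z : ∀ Θ, LipschitzWith (K₁ Θ) (fun z => uhat z Θ))
    (hLip_Θ : ∀ z, LipschitzWith K₂ (fun Θ => uhat z Θ))
    (h_zero : ∀ Θ, uhat 0 Θ = 0) (ubar : Euc N) (σ : ℝ) (Θ : Euc L)
    (hdiff : ∀ᵐ x ∂(stdGaussian (Euc N)),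
      DifferentiableAt ℝ (fun Θ' => uhat (ubar + σ • x) Θ') Θ) :
    HasGradientAt
      (fun Θ' => ∫ x, ‖uhat (ubar + σ • x) Θ' - ubar‖ ^ 2 ∂(stdGaussian (Euc N)))
      (∫ x, (2 : ℝ) • (jacobian uhat (ubar + σ • x) Θ).adjoint
        (uhat (ubar + σ • x) Θ - ubar) ∂(stdGaussian (Euc N))) Θ := by
  set γ := stdGaussian (Euc N) with hγ
  set G : Euc N → Euc L := fun x => (2 : ℝ) • (jacobian uhat (ubar + σ • x) Θ).adjoint
        (uhat (ubar + σ • x) Θ - ubar) with hG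
  have hu (T : Euc L) : Continuous fun x => uhat (ubar + σ • x) T :=
    (hLip_z T).continuous.comp (by fun_prop)
  have hJ := stronglyMeasurable_adjoint_jacobian (continuous_estimator hLip_z hLip_Θ) Θ
  have hGm : StronglyMeasurable G :=
    (stronglyMeasurable_clm_apply
      (hJ.comp_measurable (by fun_prop : Measurable fun x : Euc N => ubar + σ • x))
      ((hu Θ).sub continuous_const).stronglyMeasurable).fun_const_smul _
  have hGi : Integrable G γ := by
    refine ((integrable_norm_estimator_sub hLip_z h_zero ubar σ Θ 1 (by norm_num)).const_mul
      (2 * K₂ : ℝ)).mono' hGm.aestronglyMeasurable (ae_of_all _ fun x => ?_)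
    rw [hG, norm_smul, pow_one, Real.norm_eq_abs, abs_two, mul_assoc]
    gcongr
    exact ContinuousLinearMap.le_of_opNorm_le _ (norm_adjoint_jacobian_le hLip_Θ _ Θ) _
  have hbound : Integrable (fun x =>
      2 * K₂ * (‖uhat (ubar + σ • x) 0 - ubar‖ + K₂ * (‖Θ‖ + 1))) γ := by
    have := integrable_norm_estimator_sub hLip_z h_zero ubar σ 0 1 (by norm_num)
    simp_rw [pow_one] at this
    exact (this.add (integrable_const _)).const_mul _
  have hball : Metric.ball (0 : Euc L) (‖Θ‖ + 1) ∈ 𝓝 Θ :=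
    Metric.isOpen_ball.mem_nhds (by simp)
  obtain ⟨hint, hder⟩ := hasFDerivAt_integral_of_dominated_loc_of_lip (μ := γ)
    (F := fun T x => ‖uhat (ubar + σ • x) T - ubar‖ ^ 2)
    (F' := fun x => InnerProductSpace.toDual ℝ (Euc L) (G x)) hball
    (Eventually.of_forall fun T => (((hu T).sub continuous_const).norm.pow 2).aestronglyMeasurable)
    (integrable_norm_estimator_sub hLip_z h_zero ubar σ Θ 2 le_rfl)
    ((InnerProductSpace.toDual ℝ (Euc L)).continuous.comp_aestronglyMeasurable
      hGm.aestronglyMeasurable)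
    (ae_of_all _ fun x => by
      refine LipschitzOnWith.of_dist_le_mul fun T hT T' hT' => ?_
      rw [Real.dist_eq, dist_eq_norm, Real.coe_nnabs]
      refine (abs_sq_norm_estimator_sub_le hLip_Θ _ _ hT hT').trans ?_
      gcongr
      exact le_abs_self _) hbound
    (hdiff.mono fun x hx =>
      hasGradientAt_iff_hasFDerivAt.1 (hasGradientAt_sq_norm_estimator_sub hx ubar))
  rw [hasGradientAt_iff_hasFDerivAt]
  refine hder.congr_fderiv ?_
  ext v
  rw [ContinuousLinearMap.integral_apply hint]
  simp only [InnerProductSpace.toDual_apply_apply]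
  simp_rw [real_inner_comm v]
  exact integral_inner hGi v

lemma lipschitzOn_ball_gaussianRisk (hLip_z : ∀ Θ, LipschitzWith (K₁ Θ) (fun z => uhat z Θ))
    (hLip_Θ : ∀ z, LipschitzWith K₂ (fun Θ => uhat z Θ))
    (h_zero : ∀ Θ, uhat 0 Θ = 0) (ubar : Euc N) (σ : ℝ) (r : ℝ) :
    ∃ C : ℝ≥0, LipschitzOnWith C
      (fun Θ : Euc L => ∫ x, ‖uhat (ubar + σ • x) Θ - ubar‖ ^ 2 ∂(stdGaussian (Euc N)))
      (Metric.ball 0 r) := by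
  set γ := stdGaussian (Euc N) with hγ
  have hbound : Integrable (fun x =>
      2 * K₂ * (‖uhat (ubar + σ • x) 0 - ubar‖ + K₂ * r)) γ := by
    have := integrable_norm_estimator_sub hLip_z h_zero ubar σ 0 1 (by norm_num)
    simp_rw [pow_one] at this
    exact (this.add (integrable_const _)).const_mul _
  refine ⟨Real.toNNReal (∫ x, 2 * K₂ * (‖uhat (ubar + σ • x) 0 - ubar‖ + K₂ * r) ∂γ),
    LipschitzOnWith.of_dist_le_mul fun T hT T' hT' => ?_⟩
  have hi (S : Euc L) := integrable_norm_estimator_sub hLip_z h_zero ubar σ S 2 le_rfl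
  rw [dist_eq_norm, dist_eq_norm, ← integral_sub (hi T) (hi T')]
  refine (norm_integral_le_of_norm_le (hbound.mul_const ‖T - T'‖) (ae_of_all _ fun x =>
    abs_sq_norm_estimator_sub_le hLip_Θ _ _ hT hT')).trans ?_
  rw [integral_mul_const]
  gcongr
  exact Real.le_coe_toNNReal _

/-- Rademacher's theorem for each fixed `x`, exchanged with the almost sure quantifier by Fubini's
theorem for the jointly measurable differentiability set. -/
lemma ae_ae_differentiableAt_estimator (hLip_z : ∀ Θ, LipschitzWith (K₁ Θ) (fun z => uhat z Θ))
    (hLip_Θ : ∀ z, LipschitzWith K₂ (fun Θ => uhat z Θ)) (μ : Measure (Euc N)) [SFinite μ] :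
    ∀ᵐ Θ : Euc L, ∀ᵐ z ∂μ, DifferentiableAt ℝ (fun Θ' => uhat z Θ') Θ := by
  have hmeas : MeasurableSet {p : Euc N × Euc L | DifferentiableAt ℝ (uhat p.1) p.2} :=
    measurableSet_of_differentiableAt_with_param ℝ (continuous_estimator hLip_z hLip_Θ)
  exact (Measure.ae_ae_comm (p := fun z Θ => DifferentiableAt ℝ (uhat z) Θ) hmeas).1
    (ae_of_all _ fun z => (hLip_Θ z).ae_differentiableAt)

end Risk

/-! ### Unbiasedness of the averaged SURE and SUGAR -/

theorem proposition2 {N L R : ℕ} (hR : 0 < R)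
    -- the parametric estimator
    (uhat : Euc N → Euc L → Euc N) (K₁ : Euc L → ℝ≥0) (K₂ : ℝ≥0)
    (hLip_z : ∀ Θ, LipschitzWith (K₁ Θ) (fun z => uhat z Θ))
    (hLip_Θ : ∀ z, LipschitzWith K₂ (fun Θ => uhat z Θ))
    (h_zero : ∀ Θ, uhat 0 Θ = 0)
    -- the observation model and the Monte Carlo vectors
    {Ω : Type*} [MeasurableSpace Ω] (P : Measure Ω) [IsProbabilityMeasure P]
    (ubar : Euc N) (σ : ℝ) (hσ : 0 < σ)
    (ζ : Ω → Euc N) (δ : Fin R → Ω → Euc N)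
    (hζ : HasLaw ζ (stdGaussian (Euc N)) P)
    (hδ : ∀ r, HasLaw (δ r) (stdGaussian (Euc N)) P)
    (hδ_indep : iIndepFun δ P)
    (hζδ_indep : IndepFun ζ (fun ω r => δ r ω) P) :
    -- the averaged SURE is asymptotically unbiased for the risk
    (∀ Θ : Euc L,
      Integrable (fun ω => ‖uhat (observation ubar σ ζ ω) Θ - ubar‖ ^ 2) P ∧
      (∀ ε : ℝ, 0 < ε → Integrable
        (fun ω => avgSure uhat σ ε (fun r => δ r ω) (observation ubar σ ζ ω) Θ) P) ∧
      Tendsto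
        (fun ε : ℝ => ∫ ω, avgSure uhat σ ε (fun r => δ r ω) (observation ubar σ ζ ω) Θ ∂P)
        (𝓝[>] 0) (𝓝 (quadraticRisk P uhat ubar σ ζ Θ))) ∧
    -- the averaged SUGAR is asymptotically unbiased for the gradient of the risk
    ((∀ (Θ : Euc L) (ε : ℝ), 0 < ε → Integrable
        (fun ω => avgSugar uhat σ ε (fun r => δ r ω) (observation ubar σ ζ ω) Θ) P) ∧
      (∀ᵐ Θ : Euc L, ∀ᵐ ω ∂P,
        DifferentiableAt ℝ (fun Θ' => uhat (observation ubar σ ζ ω) Θ') Θ) ∧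
      (∀ Θ : Euc L,
        (∀ᵐ ω ∂P, DifferentiableAt ℝ (fun Θ' => uhat (observation ubar σ ζ ω) Θ') Θ) →
        DifferentiableAt ℝ (quadraticRisk P uhat ubar σ ζ) Θ ∧
        Tendsto
          (fun ε : ℝ => ∫ ω, avgSugar uhat σ ε (fun r => δ r ω) (observation ubar σ ζ ω) Θ ∂P)
          (𝓝[>] 0) (𝓝 (gradient (quadraticRisk P uhat ubar σ ζ) Θ))) ∧
      HasWeakGradient (quadraticRisk P uhat ubar σ ζ)
        (gradient (quadraticRisk P uhat ubar σ ζ))) ∧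
    -- the averaged SUGAR is exactly the gradient of the averaged SURE, for every realization
    (∀ ε : ℝ, 0 < ε → ∀ (z : Euc N) (D : Fin R → Euc N),
      (∀ Θ : Euc L, DifferentiableAt ℝ (fun Θ' => uhat z Θ') Θ →
        (∀ r, DifferentiableAt ℝ (fun Θ' => uhat (z + ε • D r) Θ') Θ) →
        HasGradientAt (avgSure uhat σ ε D z) (avgSugar uhat σ ε D z Θ) Θ) ∧
      (∀ᵐ Θ : Euc L, HasGradientAt (avgSure uhat σ ε D z) (avgSugar uhat σ ε D z Θ) Θ) ∧
      HasWeakGradient (avgSure uhat σ ε D z) (avgSugar uhat σ ε D z)) := by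
  have hcont := continuous_estimator hLip_z hLip_Θ
  have hu (Θ : Euc L) : Continuous fun x => uhat (ubar + σ • x) Θ :=
    (hLip_z Θ).continuous.comp (by fun_prop)
  have hR0 : (R : ℝ) ≠ 0 := by exact_mod_cast hR.ne'
  -- only the law of each pair `(ζ, δ r)` matters, by linearity of the Monte Carlo average
  have hpair (r : Fin R) : HasLaw (fun ω => (ζ ω, δ r ω))
      ((stdGaussian (Euc N)).prod (stdGaussian (Euc N))) P := by
    have hind : IndepFun ζ (δ r) P := hζδ_indep.comp measurable_id (measurable_pi_apply r)
    refine ⟨hζ.aemeasurable.prodMk (hδ r).aemeasurable, ?_⟩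
    rw [(indepFun_iff_map_prod_eq_prod_map_map hζ.aemeasurable (hδ r).aemeasurable).1 hind,
      hζ.map_eq, (hδ r).map_eq]
  have hrisk : quadraticRisk P uhat ubar σ ζ = fun Θ =>
      ∫ x, ‖uhat (ubar + σ • x) Θ - ubar‖ ^ 2 ∂(stdGaussian (Euc N)) := by
    funext Θ
    exact hζ.integral_comp (f := fun x => ‖uhat (ubar + σ • x) Θ - ubar‖ ^ 2)
      (((hu Θ).sub continuous_const).norm.pow 2).aestronglyMeasurable
  have hdiff_iff (Θ : Euc L) :
      (∀ᵐ ω ∂P, DifferentiableAt ℝ (fun Θ' => uhat (observation ubar σ ζ ω) Θ') Θ) ↔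
      ∀ᵐ x ∂(stdGaussian (Euc N)), DifferentiableAt ℝ (fun Θ' => uhat (ubar + σ • x) Θ') Θ := by
    refine hζ.ae_iff (p := fun x => DifferentiableAt ℝ (fun Θ' => uhat (ubar + σ • x) Θ') Θ) ?_
    have hm : Measurable fun x : Euc N => (ubar + σ • x, Θ) := by fun_prop
    exact measurableSet_setOfPred.1 (hm (measurableSet_of_differentiableAt_with_param ℝ hcont))
  have hae : ∀ᵐ Θ : Euc L, ∀ᵐ ω ∂P,
      DifferentiableAt ℝ (fun Θ' => uhat (observation ubar σ ζ ω) Θ') Θ := by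
    have h := ae_ae_differentiableAt_estimator (uhat := fun x Θ => uhat (ubar + σ • x) Θ)
      (K₁ := fun Θ => K₁ Θ * ‖σ‖₊) (K₂ := K₂)
      (fun Θ => (hLip_z Θ).comp (LipschitzWith.of_dist_le_mul fun x y => by
        simp [dist_add_left, dist_smul₀])) (fun x => hLip_Θ _) (stdGaussian (Euc N))
    filter_upwards [h] with Θ hΘ using (hdiff_iff Θ).2 hΘ
  have hgrad (Θ : Euc L)
      (h : ∀ᵐ ω ∂P, DifferentiableAt ℝ (fun Θ' => uhat (observation ubar σ ζ ω) Θ') Θ) :=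
    hasGradientAt_gaussianRisk hLip_z hLip_Θ h_zero ubar σ Θ ((hdiff_iff Θ).1 h)
  rw [← hrisk] at hgrad
  have hSure (Θ : Euc L) := fdmcSure_asymptotically_unbiased hLip_z h_zero ubar hσ Θ
  have hSugar (Θ : Euc L) := fdmcSugar_asymptotically_unbiased hLip_z hLip_Θ h_zero ubar hσ Θ
  have hSureInt (Θ : Euc L) (ε : ℝ) (r : Fin R) :
      Integrable (fun ω => fdmcSure uhat σ ε (δ r ω) (observation ubar σ ζ ω) Θ) P :=
    integrable_comp_of_hasLaw (hpair r) ((hSure Θ).1 ε)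
  have hSugarInt (Θ : Euc L) (ε : ℝ) (r : Fin R) :
      Integrable (fun ω => fdmcSugar uhat σ ε (δ r ω) (observation ubar σ ζ ω) Θ) P :=
    integrable_comp_of_hasLaw (hpair r) ((hSugar Θ).1 ε)
  have hSureMean (Θ : Euc L) (ε : ℝ) :
      ∫ ω, avgSure uhat σ ε (fun r => δ r ω) (observation ubar σ ζ ω) Θ ∂P
      = ∫ p : Euc N × Euc N, fdmcSure uhat σ ε p.2 (ubar + σ • p.1) Θ
        ∂((stdGaussian (Euc N)).prod (stdGaussian (Euc N))) := by
    unfold avgSure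
    rw [integral_const_mul, integral_finsetSum _ fun r _ => hSureInt Θ ε r,
      Finset.sum_congr rfl fun r _ => show
        ∫ ω, fdmcSure uhat σ ε (δ r ω) (observation ubar σ ζ ω) Θ ∂P = _ from
        (hpair r).integral_comp ((hSure Θ).1 ε).1]
    simp [hR0]
  have hSugarMean (Θ : Euc L) (ε : ℝ) :
      ∫ ω, avgSugar uhat σ ε (fun r => δ r ω) (observation ubar σ ζ ω) Θ ∂P
      = ∫ p : Euc N × Euc N, fdmcSugar uhat σ ε p.2 (ubar + σ • p.1) Θ
        ∂((stdGaussian (Euc N)).prod (stdGaussian (Euc N))) := by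
    unfold avgSugar
    rw [integral_smul, integral_finsetSum _ fun r _ => hSugarInt Θ ε r,
      Finset.sum_congr rfl fun r _ => show
        ∫ ω, fdmcSugar uhat σ ε (δ r ω) (observation ubar σ ζ ω) Θ ∂P = _ from
        (hpair r).integral_comp ((hSugar Θ).1 ε).1]
    rw [Finset.sum_const, Finset.card_univ, Fintype.card_fin, ← Nat.cast_smul_eq_nsmul ℝ,
      smul_smul, one_div, inv_mul_cancel₀ hR0, one_smul]
  refine ⟨fun Θ => ⟨?_, fun ε _ => ?_, ?_⟩, ⟨fun Θ ε _ => ?_, hae, fun Θ h => ⟨?_, ?_⟩, ?_⟩,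
    fun ε _ z D => ⟨fun Θ h hD => hasGradientAt_avgSure h hD, ?_, ?_⟩⟩
  · exact integrable_comp_of_hasLaw hζ
      (integrable_norm_estimator_sub hLip_z h_zero ubar σ Θ 2 le_rfl)
  · exact (integrable_finsetSum _ fun r _ => hSureInt Θ ε r).const_mul _
  · rw [hrisk]
    simp_rw [hSureMean]
    exact (hSure Θ).2
  · exact (integrable_finsetSum _ fun r _ => hSugarInt Θ ε r).fun_smul _
  · exact (hgrad Θ h).differentiableAt
  · rw [(hgrad Θ h).gradient]
    simp_rw [hSugarMean]
    exact (hSugar Θ).2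
  · refine hasWeakGradient_of_lipschitzOn_balls ?_ ?_
    · rw [hrisk]
      exact lipschitzOn_ball_gaussianRisk hLip_z hLip_Θ h_zero ubar σ
    · filter_upwards [hae] with Θ h using (hgrad Θ h).differentiableAt.hasGradientAt
  · exact ae_hasGradientAt_avgSure hLip_Θ σ ε z D
  · exact hasWeakGradient_of_lipschitzOn_balls (lipschitzOn_ball_avgSure hLip_Θ σ ε z D)
      (ae_hasGradientAt_avgSure hLip_Θ σ ε z D)
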